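/- For a compact space $Y$ and a finite open cover $\mathcal U$ of $Y$ put $\operatorname{ord}(\mathcal U)=\max_{y\in Y}\sum_{U\in\mathcal U}1_U(y)-1$ (read as $-1$ if $Y=\emptyset$) and $\mathcal D(\mathcal U)=\inf_{\mathcal V}\operatorname{ord}(\mathcal V)$ over the finite open covers $\mathcal V$ of $Y$ refining $\mathcal U$; the covering dimension is $\dim Y=\sup_{\mathcal U}\mathcal D(\mathcal U)$. Let $G$ be a finite group acting continuously on a compact metrizable space $X$ with $\dim X<\infty$, and let $\rho$ be any compatible metric on $X$. Let $\Sigma=\{\sigma_i:G\to\mathrm{Sym}(d_i)\}_{i\ge1}$ be a sofic approximation sequence for $G$, i.e. $d_i\to\infty$ and, for all $s,t\in G$, $\frac1{d_i}|\{a:\sigma_i(s)\sigma_i(t)a=\sigma_i(st)a\}|\to1$, and $\frac1{d_i}|\{a:\sigma_i(s)a=\sigma_i(t)a\}|\to0$ if $s\ne t$. For nonempty finite $F\subseteq G$ and $\delta>0$ let $\mathrm{Map}(\rho,F,\delta,\sigma_i)$ be the set of $\varphi:[d_i]\to X$ with $\big(\frac1{d_i}\sum_{a}\rho(\varphi(\sigma_i(s)a),s\varphi(a))^2\big)^{1/2}\le\delta$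 for all $s\in F$. For a finite open cover $\mathcal U$ of $X$ let $\mathcal U^{d}$ be the cover of $X^{[d]}$ by the products $U_1\times\cdots\times U_d$ with $U_j\in\mathcal U$, let $$\mathcal D_\Sigma(\mathcal U,\rho,F,\delta)=\varlimsup_{i\to\infty}\frac{\mathcal D\big(\mathcal U^{d_i}|_{\mathrm{Map}(\rho,F,\delta,\sigma_i)}\big)}{d_i}$$ (and $-\infty$ if $\mathrm{Map}(\rho,F,\delta,\sigma_i)=\emptyset$ for all large $i$), and let $\mathrm{mdim}_\Sigma(X)=\sup_{\mathcal U}\inf_{F}\inf_{\delta>0}\mathcal D_\Sigma(\mathcal U,\rho,F,\delta)$. Let also $\mathrm{mdim}(X)=\sup_{\mathcal U}\lim_F \mathcal D(\mathcal U^F)/|F|$ be the mean topological dimension of the action, where $\mathcal U^F=\bigvee_{s\in F}s^{-1}\mathcal U$ and the limit is taken as the nonempty finite set $F\subseteq G$ becomes more and more left invariant. Then $$\mathrm{mdim}_\Sigma(X)\le\frac1{|G|}\inf_{m\ge1}\frac{\dim X^m}{m}.$$ Moreover $\mathrm{mdim}(X)=\frac1{|G|}\dim X$. Consequently, if $\dim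 X^2<2\dim X$, then $\mathrm{mdim}_\Sigma(X)<\mathrm{mdim}(X)$; that is, the equality $\mathrm{mdim}_\Sigma(X)=\mathrm{mdim}(X)$, which holds for actions of countably infinite amenable groups, fails for every action of a finite group on such a space $X$. -/

import Mathlib

open Filter Topology
open scoped Pointwise

noncomputable section

namespace SoficMeanDim

/-! ### Covers and covering dimension -/

/-- `𝒰` is a finite open cover of `Y`. -/
structure IsFiniteOpenCover {Y : Type*} [TopologicalSpace Y] (𝒰 : Set (Set Y)) : Prop where
  finite : 𝒰.Finite
  isOpen : ∀ U ∈ 𝒰, IsOpen U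
  sUnion_eq : ⋃₀ 𝒰 = Set.univ

/-- `𝒱` refines `𝒰`: every member of `𝒱` is contained in a member of `𝒰`. -/
def Refines {Y : Type*} (𝒱 𝒰 : Set (Set Y)) : Prop :=
  ∀ V ∈ 𝒱, ∃ U ∈ 𝒰, V ⊆ U

/-- `ord 𝒰 = (max over y of the number of members of 𝒰 containing y) - 1`. For a finite cover the
numbers are bounded by the number of members of `𝒰`, so the supremum (in `ℕ`) is a maximum when `Y`
is nonempty; for empty `Y` it is `0`, so that the order is `-1`. -/
def ord {Y : Type*} (𝒰 : Set (Set Y)) : EReal :=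
  ((⨆ y : Y, {U ∈ 𝒰 | y ∈ U}.ncard : ℕ) : EReal) - 1

/-- `𝒟(𝒰)`: the least order of a finite open cover refining `𝒰`. -/
def refinedOrd {Y : Type*} [TopologicalSpace Y] (𝒰 : Set (Set Y)) : EReal :=
  ⨅ (𝒱 : Set (Set Y)) (_ : IsFiniteOpenCover 𝒱) (_ : Refines 𝒱 𝒰), ord 𝒱

/-- The covering dimension: the supremum of `𝒟(𝒰)` over all finite open covers `𝒰`. -/
def coveringDim (Y : Type*) [TopologicalSpace Y] : EReal :=
  ⨆ (𝒰 : Set (Set Y)) (_ : IsFiniteOpenCover 𝒰), refinedOrd 𝒰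

/-! ### Mean topological dimension of actions of amenable groups -/

/-- `𝒰^F`, the join of the covers `s⁻¹𝒰` for `s ∈ F`: its members are the intersections over
`s ∈ F` of sets `s⁻¹ U_s` with `U_s ∈ 𝒰`. -/
def coverJoin {G X : Type*} [Group G] [MulAction G X] (𝒰 : Set (Set X)) (F : Finset G) :
    Set (Set X) :=
  {W | ∃ U : G → Set X, (∀ s ∈ F, U s ∈ 𝒰) ∧ W = {x | ∀ s ∈ F, s • x ∈ U s}}

open Classical in
/-- `mdim(𝒰)`: the limit of `𝒟(𝒰^F) / |F|` as the nonempty finite set `F` becomes more and more left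
invariant, where `F` is `(K, δ)`-invariant if `|KF \ F| < δ |F|`. For amenable groups the limit
exists; it is written here as the upper limit. -/
def meanDimCover (G : Type*) {X : Type*} [Group G] [TopologicalSpace X] [MulAction G X]
    (𝒰 : Set (Set X)) : EReal :=
  ⨅ (K : Finset G) (_ : K.Nonempty) (δ : ℝ) (_ : 0 < δ),
    ⨆ (F : Finset G) (_ : F.Nonempty) (_ : (((K * F) \ F).card : ℝ) < δ * (F.card : ℝ)),
      refinedOrd (coverJoin 𝒰 F) / ((F.card : ℕ) : EReal)

/-- `mdim(X)`, the mean topological dimension of an action of an amenable group `G` on `X`. -/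
def meanDim (G X : Type*) [Group G] [TopologicalSpace X] [MulAction G X] : EReal :=
  ⨆ (𝒰 : Set (Set X)) (_ : IsFiniteOpenCover 𝒰), meanDimCover G 𝒰

/-! ### Sofic approximation sequences and sofic mean topological dimension -/

/-- A sofic approximation sequence `σ_i : G → Sym(d_i)` for the group `G`. -/
structure SoficApproximation (G : Type*) [Group G] where
  d : ℕ → ℕ
  d_pos : ∀ i, 0 < d i
  σ : ∀ i, G → Equiv.Perm (Fin (d i))
  tendsto_mul : ∀ s t : G,
    Tendsto (fun i => ({a : Fin (d i) | σ i s (σ i t a) = σ i (s * t) a}.ncard : ℝ) / (d i : ℝ))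
      atTop (𝓝 1)
  tendsto_free : ∀ s t : G, s ≠ t →
    Tendsto (fun i => ({a : Fin (d i) | σ i s a = σ i t a}.ncard : ℝ) / (d i : ℝ))
      atTop (𝓝 0)
  tendsto_d : Tendsto d atTop atTop

/-- The metric `ρ₂(φ, ψ) = (d⁻¹ ∑ₐ ρ(φ(a), ψ(a))²)^{1/2}` on maps `[d] → X`, where `ρ` is the
distance of `X`. -/
def dist₂ {X : Type*} [MetricSpace X] {d : ℕ} (φ ψ : Fin d → X) : ℝ :=
  Real.sqrt ((1 / (d : ℝ)) * ∑ a : Fin d, dist (φ a) (ψ a) ^ 2)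

/-- `Map(ρ, F, δ, σ)`: the maps `φ : [d] → X` with `ρ₂(φ ∘ σ_s, α_s ∘ φ) ≤ δ` for all `s ∈ F`. -/
def approxEquivariantMaps {G : Type*} (X : Type*) [Group G] [MetricSpace X] [MulAction G X]
    (F : Finset G) (δ : ℝ) {d : ℕ} (σ : G → Equiv.Perm (Fin d)) : Set (Fin d → X) :=
  {φ | ∀ s ∈ F, dist₂ (fun a => φ (σ s a)) (fun a => s • φ a) ≤ δ}

/-- The restriction of the cover `𝒰^d = {U₁ × ⋯ × U_d}` of `X^[d]` to a subset `M`. -/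
def powerCoverOn {X : Type*} (𝒰 : Set (Set X)) {d : ℕ} (M : Set (Fin d → X)) : Set (Set M) :=
  {W | ∃ U : Fin d → Set X, (∀ a, U a ∈ 𝒰) ∧ W = {φ : M | ∀ a, φ.1 a ∈ U a}}

/-- `𝒟_Σ(𝒰, ρ, F, δ)`: the upper limit of `𝒟(𝒰^d|_Map) / d` along the sofic approximation sequence,
and `-∞` if the space of approximately equivariant maps is empty for all large `i`. -/
def soficOrd {G X : Type*} [Group G] [MetricSpace X] [MulAction G X]
    (S : SoficApproximation G) (𝒰 : Set (Set X)) (F : Finset G) (δ : ℝ) : EReal :=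
  open Classical in
  if ∀ᶠ i in atTop, approxEquivariantMaps X F δ (S.σ i) = ∅ then ⊥
  else limsup (fun i =>
    refinedOrd (powerCoverOn 𝒰 (approxEquivariantMaps X F δ (S.σ i))) / ((S.d i : ℕ) : EReal)) atTop

/-- `mdim_Σ(X, ρ)`, the sofic mean topological dimension, computed with the distance `ρ` of `X`:
the supremum over finite open covers `𝒰` of the infimum over nonempty finite `F ⊆ G` and `δ > 0` of
`𝒟_Σ(𝒰, ρ, F, δ)`. -/
def soficMeanDim {G : Type*} [Group G] (S : SoficApproximation G)
    (X : Type*) [MetricSpace X] [MulAction G X] : EReal :=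
  ⨆ (𝒰 : Set (Set X)) (_ : IsFiniteOpenCover 𝒰),
    ⨅ (F : Finset G) (_ : F.Nonempty) (δ : ℝ) (_ : 0 < δ), soficOrd S 𝒰 F δ

end SoficMeanDim

end

/-!
The mean dimension of an action of a finite group `G` is `dim X / |G|`, because the only
sufficiently left invariant finite subset of `G` is `G` itself (`meanDimCover_eq`), and the join
`𝒰^G` refines `𝒰`.

For the sofic mean dimension, a sofic approximation `σ : G → Sym(d)` is, up to a small proportion of
the points, a free action; so `[d]` consists of at most `d / |G|` free orbits and few other points.
An approximately equivariant map `φ : [d] → X` is, at all but a small proportion of the points,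
close to the equivariant map with the same values at the representatives of the orbits. A fine
enough cover `𝒲` of `X` at the representatives therefore decides a member of `𝒰` at most
coordinates of `φ`. Grouping the representatives into blocks of length `m`, one expects
`𝒟(𝒰^d|_Map) ≤ (d / (|G| m)) dim X^m + o(d)`, which is the asserted inequality. The set of
exceptional coordinates depends on `φ`, and this makes a form of subadditivity of `𝒟` necessary
that takes account of the point.

This is provided by coloured refinements (`HasColouring`): `n` finite families of pairwise disjoint
open sets refining `𝒰`, such that each point `y` is missed by at most `f y` of the families. On a
normal space, `𝒟(𝒰) ≤ k` yields such families with `f = k` for *every* number `n` of colours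
(`hasColouring_of_refinedOrd_le`, Kolmogorov's trick). Conversely, if `f` is everywhere smaller than
the number of colours, then the families together form a cover, whose order is smaller than that
number (`HasColouring.refinedOrd_le`). For a fixed number of colours the functions `f` simply add
when covers are joined (`HasColouring.join`), and a cover that matters only off a set `{t ≤ 1/2}`
can be given the cost `f = 0` on this set (`HasColouring.localize`). The estimate
`refinedOrd_powerCoverOn_le` joins the covers from the blocks of representatives and the localized
covers from all coordinates. The last assertion of the theorem is the case `m = 2` of the
inequality.
-/

namespace SoficMeanDim

/-! ### Orders of covers -/

section Covers

variable {Y Z : Type*}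

lemma Refines.trans {𝒲 𝒱 𝒰 : Set (Set Y)} (h : Refines 𝒲 𝒱) (h' : Refines 𝒱 𝒰) : Refines 𝒲 𝒰 := by
  intro W hW
  obtain ⟨V, hV, hWV⟩ := h W hW
  obtain ⟨U, hU, hVU⟩ := h' V hV
  exact ⟨U, hU, hWV.trans hVU⟩

lemma bddAbove_ncard_mem {𝒱 : Set (Set Y)} (h : 𝒱.Finite) :
    BddAbove (Set.range fun y : Y => {U ∈ 𝒱 | y ∈ U}.ncard) := by
  refine ⟨𝒱.ncard, ?_⟩
  rintro _ ⟨y, rfl⟩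
  exact Set.ncard_le_ncard (fun U hU => hU.1) h

lemma ord_le_of_ncard_le {𝒱 : Set (Set Y)} {N : ℕ}
    (h : ∀ y, {U ∈ 𝒱 | y ∈ U}.ncard ≤ N + 1) : ord 𝒱 ≤ N := by
  have h1 : (⨆ y : Y, {U ∈ 𝒱 | y ∈ U}.ncard) ≤ N + 1 := ciSup_le' h
  unfold ord
  generalize (⨆ y : Y, {U ∈ 𝒱 | y ∈ U}.ncard) = c at h1
  rw [← EReal.coe_natCast, ← EReal.coe_natCast, ← EReal.coe_one, ← EReal.coe_sub,
    EReal.coe_le_coe_iff]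
  have : (c : ℝ) ≤ N + 1 := by exact_mod_cast h1
  linarith

lemma ncard_le_of_ord_le {𝒱 : Set (Set Y)} (hf : 𝒱.Finite) {N : ℕ} (h : ord 𝒱 ≤ N) (y : Y) :
    {U ∈ 𝒱 | y ∈ U}.ncard ≤ N + 1 := by
  have h1 := le_ciSup (bddAbove_ncard_mem hf) y
  refine h1.trans ?_
  unfold ord at h
  generalize (⨆ y : Y, {U ∈ 𝒱 | y ∈ U}.ncard) = c at h
  rw [← EReal.coe_natCast, ← EReal.coe_natCast, ← EReal.coe_one, ← EReal.coe_sub,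
    EReal.coe_le_coe_iff] at h
  have : (c : ℝ) ≤ N + 1 := by linarith
  exact_mod_cast this

lemma exists_ord_eq_natCast [Nonempty Y] [TopologicalSpace Y] {𝒱 : Set (Set Y)}
    (h : IsFiniteOpenCover 𝒱) : ∃ k : ℕ, ord 𝒱 = k := by
  obtain ⟨y⟩ := ‹Nonempty Y›
  have h1 := le_ciSup (bddAbove_ncard_mem h.finite) y
  have h2 : 0 < {U ∈ 𝒱 | y ∈ U}.ncard := by
    obtain ⟨U, hU, hy⟩ : y ∈ ⋃₀ 𝒱 := h.sUnion_eq ▸ Set.mem_univ y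
    exact (Set.ncard_pos (h.finite.subset fun U hU => hU.1)).2 ⟨U, hU, hy⟩
  unfold ord
  obtain ⟨k, hk⟩ := Nat.exists_eq_succ_of_ne_zero (h2.trans_le h1).ne'
  refine ⟨k, ?_⟩
  rw [hk, ← EReal.coe_natCast, ← EReal.coe_natCast, ← EReal.coe_one, ← EReal.coe_sub,
    Nat.cast_succ, add_sub_cancel_right]

variable [TopologicalSpace Y] [TopologicalSpace Z]

lemma refinedOrd_le_ord {𝒰 𝒱 : Set (Set Y)} (h : IsFiniteOpenCover 𝒱) (hr : Refines 𝒱 𝒰) :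
    refinedOrd 𝒰 ≤ ord 𝒱 :=
  iInf_le_of_le 𝒱 (iInf₂_le h hr)

lemma refinedOrd_le_of_refines {𝒰 𝒱 : Set (Set Y)} (hr : Refines 𝒱 𝒰) :
    refinedOrd 𝒰 ≤ refinedOrd 𝒱 :=
  le_iInf fun _ => le_iInf₂ fun h h' => refinedOrd_le_ord h (h'.trans hr)

lemma refinedOrd_le_coveringDim {𝒰 : Set (Set Y)} (h : IsFiniteOpenCover 𝒰) :
    refinedOrd 𝒰 ≤ coveringDim Y :=
  le_iSup₂_of_le 𝒰 h le_rfl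

lemma exists_ncard_le_of_refinedOrd_le {𝒰 : Set (Set Y)} {k : ℕ} (h : refinedOrd 𝒰 ≤ k) :
    ∃ 𝒱, IsFiniteOpenCover 𝒱 ∧ Refines 𝒱 𝒰 ∧ ∀ y, {U ∈ 𝒱 | y ∈ U}.ncard ≤ k + 1 := by
  have h1 : refinedOrd 𝒰 < ((k + 1 : ℕ) : EReal) :=
    h.trans_lt (by exact_mod_cast Nat.lt_succ_self k)
  unfold refinedOrd at h1
  simp only [iInf_lt_iff] at h1
  obtain ⟨𝒱, hc, hr, hlt⟩ := h1
  refine ⟨𝒱, hc, hr, fun y => ?_⟩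
  -- orders of covers are integers, so `ord 𝒱 < k + 1` improves to `ord 𝒱 ≤ k`
  have : Nonempty Y := ⟨y⟩
  obtain ⟨l, hl⟩ := exists_ord_eq_natCast hc
  rw [hl] at hlt
  have hlk : l < k + 1 := by exact_mod_cast hlt
  refine (ncard_le_of_ord_le hc.finite hl.le y).trans (by omega)

lemma exists_refinedOrd_eq_natCast [Nonempty Y] {𝒰 : Set (Set Y)} (h : IsFiniteOpenCover 𝒰) :
    ∃ k : ℕ, refinedOrd 𝒰 = k := by
  classical
  have hex : ∃ n : ℕ, ∃ 𝒱, IsFiniteOpenCover 𝒱 ∧ Refines 𝒱 𝒰 ∧ ord 𝒱 = n := by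
    obtain ⟨n, hn⟩ := exists_ord_eq_natCast h
    exact ⟨n, 𝒰, h, fun V hV => ⟨V, hV, le_rfl⟩, hn⟩
  refine ⟨Nat.find hex, le_antisymm ?_ ?_⟩
  · obtain ⟨𝒱, hc, hr, ho⟩ := Nat.find_spec hex
    exact ho ▸ refinedOrd_le_ord hc hr
  · refine le_iInf fun 𝒱 => le_iInf₂ fun hc hr => ?_
    obtain ⟨n, hn⟩ := exists_ord_eq_natCast hc
    rw [hn]
    exact_mod_cast Nat.find_min' hex ⟨𝒱, hc, hr, hn⟩

lemma refinedOrd_le_ncard {𝒰 : Set (Set Y)} (h : IsFiniteOpenCover 𝒰) :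
    refinedOrd 𝒰 ≤ (𝒰.ncard : ℕ) :=
  (refinedOrd_le_ord h fun V hV => ⟨V, hV, le_rfl⟩).trans <| ord_le_of_ncard_le fun _ =>
    (Set.ncard_le_ncard (fun _ hU => hU.1) h.finite).trans (Nat.le_succ _)

/-! ### Coloured refinements -/

/-- `A` is a finite family of pairwise disjoint open sets, each contained in a member of `𝒰`. It
need not cover the space. -/
structure IsDisjointRefinement (𝒰 A : Set (Set Y)) : Prop where
  finite : A.Finite
  isOpen : ∀ V ∈ A, IsOpen V
  refines : Refines A 𝒰
  disjoint : A.PairwiseDisjoint id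

open Classical in
/-- The number of colours `j` such that the family `A j` does not cover the point `y`. -/
noncomputable def missing {n : ℕ} (A : Fin n → Set (Set Y)) (y : Y) : ℕ :=
  (Finset.univ.filter fun j => y ∉ ⋃₀ A j).card

/-- There are `n` disjoint families (the colours) refining `𝒰` such that every point `y` is missed
by at most `f y` of them. -/
def HasColouring (𝒰 : Set (Set Y)) (n : ℕ) (f : Y → ℕ) : Prop :=
  ∃ A : Fin n → Set (Set Y), (∀ j, IsDisjointRefinement 𝒰 (A j)) ∧ ∀ y, missing A y ≤ f y

lemma HasColouring.of_refines {𝒰 𝒱 : Set (Set Y)} {n : ℕ} {f : Y → ℕ} (h : HasColouring 𝒱 n f)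
    (hr : Refines 𝒱 𝒰) : HasColouring 𝒰 n f := by
  obtain ⟨A, hA, hf⟩ := h
  exact ⟨A, fun j => ⟨(hA j).finite, (hA j).isOpen, (hA j).refines.trans hr, (hA j).disjoint⟩, hf⟩

lemma HasColouring.of_le {𝒰 : Set (Set Y)} {n : ℕ} {f : Y → ℕ} (h : ∀ y, n ≤ f y) :
    HasColouring 𝒰 n f := by
  refine ⟨fun _ => ∅, fun j => ⟨Set.finite_empty, by simp, fun V hV => hV.elim, by simp⟩,
    fun y => ?_⟩
  exact (Finset.card_le_univ _).trans (by simpa using h y)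

/-- Members of one colour are disjoint, so a point lies in at most one member of each colour. -/
lemma HasColouring.refinedOrd_le {𝒰 : Set (Set Y)} {N : ℕ} {f : Y → ℕ}
    (h : HasColouring 𝒰 (N + 1) f) (hf : ∀ y, f y ≤ N) : refinedOrd 𝒰 ≤ N := by
  classical
  obtain ⟨A, hA, hm⟩ := h
  have hc : IsFiniteOpenCover (⋃ j, A j) := by
    refine ⟨Set.finite_iUnion fun j => (hA j).finite, ?_, ?_⟩
    · intro U hU
      obtain ⟨j, hj⟩ := Set.mem_iUnion.1 hU
      exact (hA j).isOpen U hj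
    · refine Set.eq_univ_of_forall fun y => ?_
      by_contra hy
      have hall : ∀ j, y ∉ ⋃₀ A j := by
        rintro j ⟨V, hV, hyV⟩
        exact hy ⟨V, Set.mem_iUnion.2 ⟨j, hV⟩, hyV⟩
      have h1 := (hm y).trans (hf y)
      rw [missing, Finset.filter_true_of_mem fun j _ => hall j] at h1
      simp at h1
  refine (refinedOrd_le_ord hc ?_).trans (ord_le_of_ncard_le fun y => ?_)
  · intro V hV
    obtain ⟨j, hj⟩ := Set.mem_iUnion.1 hV
    exact (hA j).refines V hj
  · have hcol : ∀ U ∈ {U ∈ ⋃ j, A j | y ∈ U}, ∃ j, U ∈ A j := fun U hU => Set.mem_iUnion.1 hU.1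
    choose! c hcA using hcol
    have := Set.ncard_le_ncard_of_injOn (s := {U ∈ ⋃ j, A j | y ∈ U})
      (t := (Set.univ : Set (Fin (N + 1)))) c (fun _ _ => Set.mem_univ _) ?_
    · simpa [Set.ncard_univ] using this
    · intro U hU V hV hUV
      by_contra hne
      exact Set.disjoint_left.1 ((hA (c U)).disjoint (hcA U hU) (hUV ▸ hcA V hV) hne) hU.2 hV.2

/-- An open cover of order at most `k` is refined by `k + 1` disjoint open families that cover: for
a subordinate partition of unity, the colour of a point is the number of functions that are
positive there. -/
lemma hasColouring_succ_of_refinedOrd_le [NormalSpace Y] {𝒰 : Set (Set Y)} {k : ℕ}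
    (h : refinedOrd 𝒰 ≤ k) : HasColouring 𝒰 (k + 1) fun _ => k := by
  classical
  obtain ⟨𝒱, hc, hr, hk⟩ := exists_ncard_le_of_refinedOrd_le h
  have : Fintype 𝒱 := hc.finite.fintype
  obtain ⟨f, hf⟩ := PartitionOfUnity.exists_isSubordinate_of_locallyFinite
    (s := (Set.univ : Set Y)) isClosed_univ (fun V : 𝒱 => (V : Set Y)) (fun V => hc.isOpen V V.2)
    (locallyFinite_of_finite _) (by rw [← Set.sUnion_eq_iUnion, hc.sUnion_eq])
  have hfV : ∀ (V : 𝒱) y, 0 < f V y → y ∈ (V : Set Y) := fun V y hy =>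
    hf V (subset_tsupport _ hy.ne')
  let W : Finset 𝒱 → Set Y := fun S => {y | ∀ V ∈ S, 0 < f V y ∧ ∀ V' ∉ S, f V' y < f V y}
  have hWo : ∀ S, IsOpen (W S) := by
    intro S
    have : W S = ⋂ V ∈ S, ({y | 0 < f V y} ∩ ⋂ V' ∈ (Sᶜ : Finset 𝒱), {y | f V' y < f V y}) := by
      ext y; simp [W]
    rw [this]
    exact isOpen_biInter_finset fun V _ =>
      (isOpen_lt continuous_const (f V).continuous).inter <| isOpen_biInter_finset fun V' _ =>
        isOpen_lt (f V').continuous (f V).continuous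
  refine ⟨fun j => W '' {S | S.card = (j : ℕ) + 1}, fun j => ⟨(Set.toFinite _).image _, ?_, ?_, ?_⟩,
    fun y => ?_⟩
  · rintro _ ⟨S, -, rfl⟩
    exact hWo S
  · rintro _ ⟨S, hS, rfl⟩
    have hpos : 0 < S.card := by rw [Set.mem_ofPred_eq] at hS; omega
    obtain ⟨V, hV⟩ := Finset.card_pos.1 hpos
    obtain ⟨U, hU, hVU⟩ := hr V V.2
    exact ⟨U, hU, fun y hy => hVU (hfV V y (hy V hV).1)⟩
  · rintro _ ⟨S, hS, rfl⟩ _ ⟨T, hT, rfl⟩ hne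
    have hST : S ≠ T := fun h => hne (by rw [h])
    have hcard : S.card = T.card := by
      rw [Set.mem_ofPred_eq] at hS hT; omega
    obtain ⟨V, hVS, hVT⟩ :=
      Finset.not_subset.1 fun h => hST (Finset.eq_of_subset_of_card_le h hcard.ge)
    obtain ⟨V', hVT', hVS'⟩ :=
      Finset.not_subset.1 fun h => hST (Finset.eq_of_subset_of_card_le h hcard.le).symm
    refine Set.disjoint_left.2 fun y hy hy' => ?_
    exact lt_asymm ((hy V hVS).2 V' hVS') ((hy' V' hVT').2 V hVT)
  · let S : Finset 𝒱 := Finset.univ.filter fun V => 0 < f V y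
    have hyS : y ∈ W S := by
      intro V hV
      have hV' : 0 < f V y := (Finset.mem_filter.1 hV).2
      refine ⟨hV', fun V' hV'' => lt_of_le_of_lt ?_ hV'⟩
      by_contra hlt
      exact hV'' (Finset.mem_filter.2 ⟨Finset.mem_univ _, not_le.1 hlt⟩)
    have hS0 : 0 < S.card := by
      obtain ⟨V, hV⟩ := f.exists_pos (Set.mem_univ y)
      exact Finset.card_pos.2 ⟨V, Finset.mem_filter.2 ⟨Finset.mem_univ _, hV⟩⟩
    have hSk : S.card ≤ k + 1 := by
      refine le_trans ?_ (hk y)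
      rw [← Finset.card_map (Function.Embedding.subtype _), ← Set.ncard_coe_finset]
      refine Set.ncard_le_ncard ?_ (hc.finite.subset fun U hU => hU.1)
      intro U hU
      obtain ⟨V, hV, rfl⟩ := Finset.mem_map.1 (Finset.mem_coe.1 hU)
      exact ⟨V.2, hfV V y (Finset.mem_filter.1 hV).2⟩
    have hlt : S.card - 1 < k + 1 := by omega
    have : missing (fun j : Fin (k + 1) => W '' {S | S.card = (j : ℕ) + 1}) y
        ≤ (Finset.univ.erase (⟨S.card - 1, hlt⟩ : Fin (k + 1))).card := by
      refine Finset.card_le_card fun j hj => Finset.mem_erase.2 ⟨?_, Finset.mem_univ _⟩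
      rintro rfl
      exact (Finset.mem_filter.1 hj).2 ⟨W S, ⟨S, by simp only [Set.mem_ofPred_eq]; omega, rfl⟩, hyS⟩
    simpa using this

/-- Open sets covering every point at least `n - k` times can be shrunk, with closures inside the
original sets, without losing that property. -/
lemma exists_closure_subset_of_card_le [NormalSpace Y] {n k : ℕ} (U : Fin n → Set Y)
    (hU : ∀ i, IsOpen (U i))
    (hk : ∀ y, ∃ S : Finset (Fin n), n ≤ S.card + k ∧ ∀ i ∈ S, y ∈ U i) :
    ∃ U' : Fin n → Set Y, (∀ i, IsOpen (U' i)) ∧ (∀ i, closure (U' i) ⊆ U i) ∧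
      ∀ y, ∃ S : Finset (Fin n), n ≤ S.card + k ∧ ∀ i ∈ S, y ∈ U' i := by
  -- shrink the cover by the intersections of at least `n - k` of the sets
  obtain ⟨O, hOu, hOo, hOc⟩ := exists_iUnion_eq_closure_subset
    (u := fun S : {S : Finset (Fin n) // n ≤ S.card + k} => ⋂ i ∈ S.1, U i)
    (fun S => isOpen_biInter_finset fun i _ => hU i) (fun y => Set.toFinite _)
    (Set.eq_univ_of_forall fun y => by
      obtain ⟨S, hS, hy⟩ := hk y
      exact Set.mem_iUnion.2 ⟨⟨S, hS⟩, Set.mem_iInter₂.2 hy⟩)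
  refine ⟨fun i => ⋃ S : {S : {S : Finset (Fin n) // n ≤ S.card + k} // i ∈ S.1}, O S.1,
    fun i => isOpen_iUnion fun S => hOo _, fun i => ?_, fun y => ?_⟩
  · rw [closure_iUnion_of_finite]
    exact Set.iUnion_subset fun S => (hOc S.1).trans (Set.biInter_subset_of_mem S.2)
  · obtain ⟨S, hS⟩ := Set.mem_iUnion.1 (hOu ▸ Set.mem_univ y : y ∈ ⋃ S, O S)
    exact ⟨S.1, S.2, fun i hi => Set.mem_iUnion.2 ⟨⟨S, hi⟩, hS⟩⟩

/-- One more colour can be added without increasing the number of colours that miss a point. The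
new colour has to cover the points missed by exactly `k` of the old ones. -/
lemma HasColouring.succ [NormalSpace Y] {𝒰 : Set (Set Y)} {n k : ℕ} (hkn : k < n)
    (h : HasColouring 𝒰 n fun _ => k) : HasColouring 𝒰 (n + 1) fun _ => k := by
  classical
  obtain ⟨A, hA, hm⟩ := h
  have hcompl : ∀ y, (Finset.univ.filter fun j => y ∈ ⋃₀ A j).card + missing A y = n := by
    intro y
    simpa [missing] using Finset.card_filter_add_card_filter_not
      (s := (Finset.univ : Finset (Fin n))) (fun j => y ∈ ⋃₀ A j)
  obtain ⟨U', hU'o, hU'c, hU'k⟩ := exists_closure_subset_of_card_le (k := k) (fun j => ⋃₀ A j)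
    (fun j => isOpen_sUnion (hA j).isOpen) fun y => by
      refine ⟨Finset.univ.filter fun j => y ∈ ⋃₀ A j, ?_, fun i hi => (Finset.mem_filter.1 hi).2⟩
      have h1 := hcompl y; have h2 : missing A y ≤ k := hm y; omega
  let W : Finset (Fin n) → Set Y := fun S => {y | (∀ i ∈ S, y ∈ U' i) ∧ ∀ i ∉ S, y ∉ closure (U' i)}
  have hWo : ∀ S, IsOpen (W S) := by
    intro S
    have : W S = (⋂ i ∈ S, U' i) ∩ ⋂ i ∈ (Sᶜ : Finset (Fin n)), (closure (U' i))ᶜ := by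
      ext y; simp [W]
    rw [this]
    exact (isOpen_biInter_finset fun i _ => hU'o i).inter
      (isOpen_biInter_finset fun i _ => isClosed_closure.isOpen_compl)
  have hne : ∀ S : Finset (Fin n), S.card + k = n → ∃ i, i ∈ S := fun S hS =>
    Finset.card_pos.1 (by omega)
  have : Nonempty (Fin n) := ⟨⟨k, hkn⟩⟩
  choose! p hp using hne
  let B : Set (Set Y) :=
    ⋃ S ∈ {S : Finset (Fin n) | S.card + k = n}, (fun V => W S ∩ V) '' A (p S)
  have hB : IsDisjointRefinement 𝒰 B := by
    refine ⟨(Set.toFinite _).biUnion fun S _ => (hA (p S)).finite.image _, ?_, ?_, ?_⟩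
    · intro V₁ hV₁
      obtain ⟨S, hS, V, hV, rfl⟩ := Set.mem_iUnion₂.1 hV₁
      exact (hWo S).inter ((hA _).isOpen V hV)
    · intro V₁ hV₁
      obtain ⟨S, hS, V, hV, rfl⟩ := Set.mem_iUnion₂.1 hV₁
      obtain ⟨U, hU, hVU⟩ := (hA _).refines V hV
      exact ⟨U, hU, Set.inter_subset_right.trans hVU⟩
    · intro V₁ hV₁ V₂ hV₂ hne
      obtain ⟨S, hS, V, hV, rfl⟩ := Set.mem_iUnion₂.1 hV₁
      obtain ⟨T, hT, V', hV', rfl⟩ := Set.mem_iUnion₂.1 hV₂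
      by_cases hST : S = T
      · subst hST
        have hVV : V ≠ V' := fun h => hne (by rw [h])
        exact ((hA _).disjoint hV hV' hVV).mono Set.inter_subset_right Set.inter_subset_right
      · have hcard : T.card ≤ S.card := by
          rw [Set.mem_ofPred_eq] at hS hT; omega
        obtain ⟨i, hiS, hiT⟩ :=
          Finset.not_subset.1 fun h => hST (Finset.eq_of_subset_of_card_le h hcard)
        exact Set.disjoint_left.2 fun y hy hy' => hy'.1.2 i hiT (subset_closure (hy.1.1 i hiS))
  refine ⟨Fin.cons B A, fun j => Fin.cases hB hA j, fun y => ?_⟩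
  have hsum : missing (Fin.cons B A : Fin (n + 1) → Set (Set Y)) y
      = (if y ∈ ⋃₀ B then 0 else 1) + missing A y := by
    rw [missing, Fin.card_filter_univ_succ]
    simp only [Fin.cons_zero, Fin.cons_succ, missing]
    split_ifs <;> omega
  rw [hsum]
  have hmy : missing A y ≤ k := hm y
  split_ifs with hy
  · simpa using hmy
  · by_contra hlt
    beta_reduce at hlt
    have hmk : missing A y = k := by omega
    obtain ⟨S, hS, hyS⟩ := hU'k y
    have hsub : S ⊆ Finset.univ.filter fun j => y ∈ ⋃₀ A j := fun i hi =>
      Finset.mem_filter.2 ⟨Finset.mem_univ _, hU'c i (subset_closure (hyS i hi))⟩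
    have hceq := hcompl y
    have hSeq := Finset.eq_of_subset_of_card_le hsub (by omega)
    have hSk : S.card + k = n := by rw [hSeq]; omega
    have hyW : y ∈ W S := by
      refine ⟨hyS, fun i hi hcl => hi ?_⟩
      rw [hSeq]
      exact Finset.mem_filter.2 ⟨Finset.mem_univ _, hU'c i hcl⟩
    obtain ⟨V, hV, hyV⟩ := hU'c (p S) (subset_closure (hyS _ (hp S hSk)))
    exact hy ⟨W S ∩ V, Set.mem_iUnion₂.2 ⟨S, hSk, V, hV, rfl⟩, hyW, hyV⟩

/-- Kolmogorov's trick: a cover with `𝒟(𝒰) ≤ k` has colourings with any number of colours in which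
every point is missed by at most `k` colours. -/
lemma hasColouring_of_refinedOrd_le [NormalSpace Y] {𝒰 : Set (Set Y)} {k : ℕ}
    (h : refinedOrd 𝒰 ≤ k) (n : ℕ) : HasColouring 𝒰 n fun _ => k := by
  rcases le_or_gt n k with hn | hn
  · exact HasColouring.of_le fun _ => hn
  · induction n, hn using Nat.le_induction with
    | base => exact hasColouring_succ_of_refinedOrd_le h
    | succ n hn ih => exact ih.succ hn

lemma HasColouring.preimage {𝒰 : Set (Set Y)} {n : ℕ} {f : Y → ℕ} (h : HasColouring 𝒰 n f)
    {g : Z → Y} (hg : Continuous g) :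
    HasColouring ((fun U => g ⁻¹' U) '' 𝒰) n (fun z => f (g z)) := by
  obtain ⟨A, hA, hm⟩ := h
  refine ⟨fun j => (fun U => g ⁻¹' U) '' A j, fun j => ⟨(hA j).finite.image _, ?_, ?_, ?_⟩,
    fun z => ?_⟩
  · rintro _ ⟨V, hV, rfl⟩
    exact ((hA j).isOpen V hV).preimage hg
  · rintro _ ⟨V, hV, rfl⟩
    obtain ⟨U, hU, hVU⟩ := (hA j).refines V hV
    exact ⟨_, ⟨U, hU, rfl⟩, Set.preimage_mono hVU⟩
  · rintro _ ⟨V, hV, rfl⟩ _ ⟨V', hV', rfl⟩ hne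
    exact ((hA j).disjoint hV hV' fun h => hne (by rw [h])).preimage g
  · refine le_trans (le_of_eq ?_) (hm (g z))
    unfold missing
    congr! 3
    simp

/-- Passing to the join of covers, the numbers of missing colours add up at most. -/
lemma HasColouring.join {ι : Type*} [Fintype ι] {𝒰 : ι → Set (Set Y)} {n : ℕ} {f : ι → Y → ℕ}
    (h : ∀ i, HasColouring (𝒰 i) n (f i)) :
    HasColouring ((fun U : ι → Set Y => ⋂ i, U i) '' Set.univ.pi 𝒰) n fun y => ∑ i, f i y := by
  classical
  choose A hA hm using h
  refine ⟨fun j => (fun U : ι → Set Y => ⋂ i, U i) '' Set.univ.pi fun i => A i j,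
    fun j => ⟨(Set.Finite.pi fun i => (hA i j).finite).image _, ?_, ?_, ?_⟩, fun y => ?_⟩
  · rintro _ ⟨V, hV, rfl⟩
    exact isOpen_iInter_of_finite fun i => (hA i j).isOpen _ (hV i trivial)
  · rintro _ ⟨V, hV, rfl⟩
    choose U hU hVU using fun i => (hA i j).refines (V i) (hV i trivial)
    exact ⟨_, ⟨U, fun i _ => hU i, rfl⟩, Set.iInter_mono hVU⟩
  · rintro _ ⟨V, hV, rfl⟩ _ ⟨V', hV', rfl⟩ hne
    obtain ⟨i, hi⟩ := Function.ne_iff.1 fun h : V = V' => hne (by rw [h])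
    exact ((hA i j).disjoint (hV i trivial) (hV' i trivial) hi).mono
      (Set.iInter_subset _ i) (Set.iInter_subset _ i)
  · refine le_trans ?_ ((Finset.card_biUnion_le (s := Finset.univ) (t := fun i =>
      Finset.univ.filter fun j => y ∉ ⋃₀ A i j)).trans (Finset.sum_le_sum fun i _ => ?_))
    · refine Finset.card_le_card fun j hj => ?_
      simp only [Finset.mem_biUnion, Finset.mem_univ, true_and, Finset.mem_filter]
      by_contra! hcon
      choose V hV hyV using hcon
      exact (Finset.mem_filter.1 hj).2
        ⟨⋂ i, V i, ⟨V, fun i _ => hV i, rfl⟩, Set.mem_iInter.2 hyV⟩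
    · exact le_trans (le_of_eq (by simp [missing])) (hm i y)

/-- A single open set `{t < 1}` can take over from the cover `𝒰` near `{t ≤ 1/2}`, at the cost of
one more missing colour outside this set: in the different colours the transition is made across
disjoint level sets of `t`. -/
lemma HasColouring.localize {𝒰 : Set (Set Y)} {n k : ℕ} (h : HasColouring 𝒰 n fun _ => k)
    {t : Y → ℝ} (ht : Continuous t) [∀ y, Decidable (t y ≤ 1 / 2)] :
    HasColouring (insert {y | t y < 1} 𝒰) n fun y => if t y ≤ 1 / 2 then 0 else k + 1 := by
  classical
  obtain ⟨A, hA, hm⟩ := h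
  obtain ⟨c, hcinj, hc⟩ : ∃ c : Fin n → ℝ, Function.Injective c ∧ ∀ j, 1 / 2 < c j ∧ c j < 1 := by
    have : (Set.Ioo (1 / 2 : ℝ) 1).Infinite := Set.Ioo_infinite (by norm_num)
    let e := this.natEmbedding
    exact ⟨fun j => e j, fun i j hij => Fin.ext (e.injective (Subtype.ext hij)), fun j => (e j).2⟩
  refine ⟨fun j => insert {y | t y < c j} ((fun V => V ∩ {y | c j < t y}) '' A j),
    fun j => ⟨((hA j).finite.image _).insert _, ?_, ?_, ?_⟩, fun y => ?_⟩
  · rintro _ (rfl | ⟨V, hV, rfl⟩)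
    · exact isOpen_lt ht continuous_const
    · exact ((hA j).isOpen V hV).inter (isOpen_lt continuous_const ht)
  · rintro _ (rfl | ⟨V, hV, rfl⟩)
    · exact ⟨_, Set.mem_insert _ _, fun y hy => lt_trans hy (hc j).2⟩
    · obtain ⟨U, hU, hVU⟩ := (hA j).refines V hV
      exact ⟨U, Set.mem_insert_of_mem _ hU, Set.inter_subset_left.trans hVU⟩
  · rintro _ (rfl | ⟨V, hV, rfl⟩) _ (rfl | ⟨V', hV', rfl⟩) hne
    · exact (hne rfl).elim
    · exact Set.disjoint_left.2 fun y hy hy' => lt_asymm (a := t y) (b := c j) hy hy'.2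
    · exact Set.disjoint_left.2 fun y hy hy' => lt_asymm (a := t y) (b := c j) hy' hy.2
    · exact ((hA j).disjoint hV hV' fun h => hne (by rw [h])).mono
        Set.inter_subset_left Set.inter_subset_left
  · have hmiss : ∀ j, y ∉ ⋃₀ insert {y | t y < c j} ((fun V => V ∩ {y | c j < t y}) '' A j) →
        t y = c j ∨ c j < t y ∧ y ∉ ⋃₀ A j := by
      intro j hj
      rcases lt_trichotomy (t y) (c j) with h1 | h1 | h1
      · exact (hj ⟨_, Set.mem_insert _ _, h1⟩).elim
      · exact Or.inl h1
      · refine Or.inr ⟨h1, ?_⟩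
        rintro ⟨V, hV, hyV⟩
        exact hj ⟨_, Set.mem_insert_of_mem _ ⟨V, hV, rfl⟩, hyV, h1⟩
    beta_reduce
    split_ifs with hy
    · rw [missing, Finset.filter_false_of_mem, Finset.card_empty]
      intro j _ hj
      have := (hc j).1
      rcases hmiss j hj with h1 | h1 <;> linarith [h1]
    · have hone : (Finset.univ.filter fun j => t y = c j).card ≤ 1 :=
        Finset.card_le_one.2 fun i hi j hj => hcinj <|
          (Finset.mem_filter.1 hi).2.symm.trans (Finset.mem_filter.1 hj).2
      refine le_trans (Finset.card_le_card (t := (Finset.univ.filter fun j => y ∉ ⋃₀ A j) ∪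
        Finset.univ.filter fun j => t y = c j) fun j hj => ?_)
        ((Finset.card_union_le _ _).trans (Nat.add_le_add ?_ hone))
      · rcases hmiss j (Finset.mem_filter.1 hj).2 with h1 | h1
        · exact Finset.mem_union_right _ (Finset.mem_filter.2 ⟨Finset.mem_univ _, h1⟩)
        · exact Finset.mem_union_left _ (Finset.mem_filter.2 ⟨Finset.mem_univ _, h1.2⟩)
      · exact le_trans (le_of_eq (by simp [missing])) (hm y)

end Covers

/-! ### Free orbits of a sofic approximation -/

section Combinatorics

variable {G : Type*} [Group G] {d : ℕ}

/-- `σ` looks like a free action of `G` at the point `a`. -/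
def IsFreePoint (σ : G → Equiv.Perm (Fin d)) (a : Fin d) : Prop :=
  (∀ s t, σ s (σ t a) = σ (s * t) a) ∧ ∀ s t, s ≠ t → σ s a ≠ σ t a

lemma IsFreePoint.map_one {σ : G → Equiv.Perm (Fin d)} {a : Fin d} (h : IsFreePoint σ a) :
    σ 1 a = a :=
  (σ 1).injective (by rw [h.1, one_mul])

lemma IsFreePoint.inv_map {σ : G → Equiv.Perm (Fin d)} {a : Fin d} (h : IsFreePoint σ a) (s : G) :
    σ s⁻¹ (σ s a) = a := by
  rw [h.1, inv_mul_cancel, h.map_one]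

/-- The free points decompose into free orbits; hence they have at most `d / |G|` orbit
representatives. -/
lemma exists_orbit_representatives [Fintype G] (σ : G → Equiv.Perm (Fin d)) :
    ∃ (R : Finset (Fin d)) (g : Fin d → G) (r : Fin d → Fin d), Fintype.card G * R.card ≤ d ∧
      ∀ a, IsFreePoint σ a → r a ∈ R ∧ σ (g a) (r a) = a := by
  classical
  let orbitRel : Setoid {a // IsFreePoint σ a} :=
    { r := fun a b => ∃ s, σ s a = b
      iseqv := ⟨fun a => ⟨1, a.2.map_one⟩, fun {a b} ⟨s, h⟩ => ⟨s⁻¹, h ▸ a.2.inv_map s⟩,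
        fun {a b c} ⟨s, h⟩ ⟨t, h'⟩ => ⟨t * s, by rw [← h', ← h, a.2.1]⟩⟩ }
  let Q := Quotient orbitRel
  let R : Finset (Fin d) := Finset.univ.image fun q : Q => (q.out : Fin d)
  have hex : ∀ a, IsFreePoint σ a → ∃ (s : G) (b : Fin d), b ∈ R ∧ σ s b = a := by
    intro a ha
    obtain ⟨s, hs⟩ : orbitRel.r (Quotient.mk orbitRel ⟨a, ha⟩).out ⟨a, ha⟩ :=
      Quotient.mk_out (s := orbitRel) ⟨a, ha⟩
    exact ⟨s, _, Finset.mem_image_of_mem _ (Finset.mem_univ _), hs⟩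
  have hcard : Fintype.card G * R.card ≤ d := by
    refine (Nat.mul_le_mul_left _ Finset.card_image_le).trans ?_
    rw [Finset.card_univ, ← Fintype.card_prod]
    refine (Fintype.card_le_of_injective (fun p : G × Q => σ p.1 (p.2.out : Fin d)) ?_).trans
      (Fintype.card_fin d).le
    rintro ⟨s, q⟩ ⟨t, q'⟩ h
    have h' : σ s (q.out : Fin d) = σ t (q'.out : Fin d) := h
    have hq : q = q' := by
      rw [← Quotient.out_eq q, ← Quotient.out_eq q']
      refine Quotient.sound ⟨t⁻¹ * s, ?_⟩
      rw [← q.out.2.1, h', q'.out.2.inv_map]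
    subst hq
    by_contra hne
    exact q.out.2.2 s t (fun hst => hne (by rw [hst])) h'
  have : Nonempty G := ⟨1⟩
  by_cases hd : Nonempty (Fin d)
  · choose! g r hg using hex
    exact ⟨R, g, r, hcard, hg⟩
  · exact ⟨R, fun _ => 1, id, hcard, fun a => (hd ⟨a⟩).elim⟩

open Classical in
/-- In a sofic approximation of a finite group almost all points are free. -/
lemma eventually_card_not_isFreePoint_le [Finite G] (S : SoficApproximation G) {η : ℝ}
    (hη : 0 < η) : ∀ᶠ i in atTop,
      ((Finset.univ.filter fun a => ¬ IsFreePoint (S.σ i) a).card : ℝ) ≤ η * S.d i := by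
  have := Fintype.ofFinite G
  let P : ℕ → G × G → ℝ := fun i p =>
    ({a : Fin (S.d i) | S.σ i p.1 (S.σ i p.2 a) = S.σ i (p.1 * p.2) a}.ncard : ℝ) / (S.d i : ℝ)
  let Q : ℕ → G × G → ℝ := fun i p => if p.1 ≠ p.2 then
    ({a : Fin (S.d i) | S.σ i p.1 a = S.σ i p.2 a}.ncard : ℝ) / (S.d i : ℝ) else 0
  have hlim : Tendsto (fun i => ∑ p, ((1 - P i p) + Q i p)) atTop (𝓝 0) := by
    have h0 : (0 : ℝ) = ∑ p : G × G, ((1 - 1) + 0 : ℝ) := by simp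
    rw [h0]
    refine tendsto_finsetSum _ fun p _ => ((S.tendsto_mul p.1 p.2).const_sub 1).add ?_
    by_cases hp : p.1 = p.2
    · simp [Q, hp]
    · simpa [Q, hp] using S.tendsto_free p.1 p.2 hp
  filter_upwards [hlim.eventually_lt_const hη] with i hi
  have hd : (0 : ℝ) < S.d i := by exact_mod_cast S.d_pos i
  have hsub : (Finset.univ.filter fun a => ¬ IsFreePoint (S.σ i) a) ⊆
      Finset.univ.biUnion fun p : G × G =>
        (Finset.univ.filter fun a => ¬ S.σ i p.1 (S.σ i p.2 a) = S.σ i (p.1 * p.2) a) ∪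
        Finset.univ.filter fun a => p.1 ≠ p.2 ∧ S.σ i p.1 a = S.σ i p.2 a := by
    intro a ha
    have ha' := (Finset.mem_filter.1 ha).2
    by_contra hcon
    simp only [Finset.mem_biUnion, Finset.mem_union, Finset.mem_filter, Finset.mem_univ, true_and,
      not_exists, not_or, not_and, not_not, Prod.forall] at hcon
    exact ha' ⟨fun s t => (hcon s t).1, fun s t => (hcon s t).2⟩
  have hcard : ((Finset.univ.filter fun a => ¬ IsFreePoint (S.σ i) a).card : ℝ) ≤
      ∑ p : G × G, ((1 - P i p) + Q i p) * S.d i := by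
    refine (Nat.cast_le.2 ((Finset.card_le_card hsub).trans Finset.card_biUnion_le)).trans ?_
    push_cast
    refine Finset.sum_le_sum fun p _ => ?_
    refine (Nat.cast_le.2 (Finset.card_union_le _ _)).trans ?_
    push_cast
    rw [add_mul]
    refine add_le_add (le_of_eq ?_) (le_of_eq ?_)
    · have h1 := Finset.card_filter_add_card_filter_not (s := (Finset.univ : Finset (Fin (S.d i))))
        fun a => S.σ i p.1 (S.σ i p.2 a) = S.σ i (p.1 * p.2) a
      rw [Finset.card_univ, Fintype.card_fin] at h1
      have h2 : ((Finset.univ.filter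
          fun a => S.σ i p.1 (S.σ i p.2 a) = S.σ i (p.1 * p.2) a).card : ℝ) +
          (Finset.univ.filter
          fun a => ¬ S.σ i p.1 (S.σ i p.2 a) = S.σ i (p.1 * p.2) a).card = S.d i := by
        exact_mod_cast h1
      simp only [P, Set.ncard_eq_toFinset_card', Set.toFinset_ofPred]
      field_simp
      linarith
    · by_cases hp : p.1 = p.2
      · simp [Q, hp]
      · simp only [Q, hp, ne_eq, not_false_eq_true, true_and, if_true,
          Set.ncard_eq_toFinset_card', Set.toFinset_ofPred]
        field_simp
  rw [← Finset.sum_mul] at hcard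
  exact hcard.trans (mul_le_mul_of_nonneg_right hi.le hd.le)

end Combinatorics

/-! ### The upper bound for the sofic mean dimension -/

section UpperBound

variable {X : Type*}

/-- The cover of `X^m` by the products of members of `𝒲`. -/
def powerCover (𝒲 : Set (Set X)) (m : ℕ) : Set (Set (Fin m → X)) :=
  (fun W : Fin m → Set X => Set.univ.pi W) '' Set.univ.pi fun _ => 𝒲

lemma IsFiniteOpenCover.powerCover [TopologicalSpace X] {𝒲 : Set (Set X)}
    (h : IsFiniteOpenCover 𝒲) (m : ℕ) : IsFiniteOpenCover (powerCover 𝒲 m) := by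
  refine ⟨(Set.Finite.pi fun _ => h.finite).image _, ?_, Set.eq_univ_of_forall fun x => ?_⟩
  · rintro _ ⟨W, hW, rfl⟩
    exact isOpen_set_pi Set.finite_univ fun i _ => h.isOpen _ (hW i trivial)
  · have hx : ∀ i, ∃ W ∈ 𝒲, x i ∈ W := fun i => Set.mem_sUnion.1 (h.sUnion_eq ▸ Set.mem_univ (x i))
    choose W hW hxW using hx
    exact ⟨_, ⟨W, fun i _ => hW i, rfl⟩, fun i _ => hxW i⟩

variable {G : Type*} [Group G] [MetricSpace X] [MulAction G X]

/-- A cover `𝒲` so fine that the `κ`-neighbourhood of every translate `s • W` lies in a member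
of `𝒰`. -/
lemma exists_fine_cover [Finite G] [CompactSpace X] [ContinuousConstSMul G X] {𝒰 : Set (Set X)}
    (h𝒰 : IsFiniteOpenCover 𝒰) : ∃ (𝒲 : Set (Set X)) (κ : ℝ), IsFiniteOpenCover 𝒲 ∧ 0 < κ ∧
      ∀ W ∈ 𝒲, ∀ s : G, ∃ U ∈ 𝒰, ∀ x ∈ W, ∀ y, dist y (s • x) < κ → y ∈ U := by
  obtain ⟨δ, hδ, hL⟩ := lebesgue_number_lemma_of_metric_sUnion isCompact_univ h𝒰.isOpen
    h𝒰.sUnion_eq.ge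
  let O : X → Set X := fun c => {x | ∀ s : G, dist (s • x) (s • c) < δ / 2}
  have hO : ∀ c, IsOpen (O c) := by
    intro c
    have : O c = ⋂ s : G, {x | dist (s • x) (s • c) < δ / 2} := by ext; simp [O]
    rw [this]
    exact isOpen_iInter_of_finite fun s =>
      isOpen_lt ((continuous_const_smul s).dist continuous_const) continuous_const
  obtain ⟨T, hT⟩ := isCompact_univ.elim_finite_subcover O hO
    fun c _ => Set.mem_iUnion.2 ⟨c, fun s => by simpa using half_pos hδ⟩
  refine ⟨O '' T, δ / 2, ⟨T.finite_toSet.image _, ?_, ?_⟩, half_pos hδ, ?_⟩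
  · rintro _ ⟨c, -, rfl⟩
    exact hO c
  · refine Set.eq_univ_of_forall fun x => ?_
    obtain ⟨c, hc, hx⟩ := Set.mem_iUnion₂.1 (hT (Set.mem_univ x))
    exact ⟨O c, ⟨c, hc, rfl⟩, hx⟩
  · rintro _ ⟨c, -, rfl⟩ s
    obtain ⟨U, hU, hball⟩ := hL (s • c) (Set.mem_univ _)
    refine ⟨U, hU, fun x hx y hy => hball ?_⟩
    have := dist_triangle y (s • x) (s • c)
    have := hx s
    rw [Metric.mem_ball]
    linarith

open Classical in
/-- By Chebyshev's inequality, an approximately equivariant map `φ` is close to equivariant at all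
but few free points. -/
lemma card_far_mul_sq_le [Fintype G] {d : ℕ} {σ : G → Equiv.Perm (Fin d)} {δ : ℝ}
    {φ : Fin d → X} (hφ : φ ∈ approxEquivariantMaps X Finset.univ δ σ) (hδ : 0 ≤ δ)
    {g : Fin d → G} {r : Fin d → Fin d} (hr : ∀ a, IsFreePoint σ a → σ (g a) (r a) = a)
    {η : ℝ} (hη : 0 ≤ η) :
    ((Finset.univ.filter fun a => IsFreePoint σ a ∧ η < dist (φ a) (g a • φ (r a))).card : ℝ)
      * η ^ 2 ≤ Fintype.card G * (d * δ ^ 2) := by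
  rcases Nat.eq_zero_or_pos d with rfl | hd
  · simp
  have hd' : (0 : ℝ) < d := by exact_mod_cast hd
  let D : G × Fin d → ℝ := fun p => dist (φ (σ p.1 p.2)) (p.1 • φ p.2) ^ 2
  have hrow : ∀ s : G, ∑ a, D (s, a) ≤ d * δ ^ 2 := by
    intro s
    have h1 := (Real.sqrt_le_left hδ).1 (hφ s (Finset.mem_univ s))
    rw [one_div, inv_mul_le_iff₀ hd'] at h1
    exact h1
  set T := Finset.univ.filter fun a => IsFreePoint σ a ∧ η < dist (φ a) (g a • φ (r a)) with hT
  have hinj : Set.InjOn (fun a => (g a, r a)) (T : Set (Fin d)) := by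
    intro a ha b hb hab
    have ha' := (Finset.mem_filter.1 (Finset.mem_coe.1 ha)).2.1
    have hb' := (Finset.mem_filter.1 (Finset.mem_coe.1 hb)).2.1
    obtain ⟨h1, h2⟩ := Prod.mk.inj hab
    rw [← hr a ha', ← hr b hb', h1, h2]
  calc (T.card : ℝ) * η ^ 2 = ∑ a ∈ T, η ^ 2 := by rw [Finset.sum_const, nsmul_eq_mul]
    _ ≤ ∑ a ∈ T, D (g a, r a) := by
        refine Finset.sum_le_sum fun a ha => ?_
        obtain ⟨hfree, hlt⟩ := (Finset.mem_filter.1 ha).2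
        simp only [D, hr a hfree]
        exact pow_le_pow_left₀ hη hlt.le 2
    _ = ∑ p ∈ T.image fun a => (g a, r a), D p := (Finset.sum_image hinj).symm
    _ ≤ ∑ p, D p := Finset.sum_le_sum_of_subset_of_nonneg (Finset.subset_univ _)
        fun p _ _ => sq_nonneg _
    _ = ∑ s, ∑ a, D (s, a) := Fintype.sum_prod_type D
    _ ≤ ∑ _s : G, (d * δ ^ 2 : ℝ) := Finset.sum_le_sum fun s _ => hrow s
    _ = Fintype.card G * (d * δ ^ 2) := by simp

/-- The main estimate. The values of `φ` at the orbit representatives, read off in blocks of length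
`m` with respect to `𝒲`, determine a member of `𝒰` for every coordinate where `φ` is close to
equivariant; the remaining coordinates, at most `c` for each `φ`, are covered directly. -/
lemma refinedOrd_powerCoverOn_le [Nonempty X] [Fintype G] [ContinuousConstSMul G X] {d : ℕ}
    {σ : G → Equiv.Perm (Fin d)} {M : Set (Fin d → X)} {𝒰 𝒲 : Set (Set X)} {κ : ℝ}
    (h𝒰 : IsFiniteOpenCover 𝒰) (h𝒲 : IsFiniteOpenCover 𝒲) (hκ : 0 < κ)
    (hfine : ∀ W ∈ 𝒲, ∀ s : G, ∃ U ∈ 𝒰, ∀ x ∈ W, ∀ y, dist y (s • x) < κ → y ∈ U)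
    {m k : ℕ} (hk : refinedOrd (powerCover 𝒲 m) ≤ k)
    {R : Finset (Fin d)} {g : Fin d → G} {r : Fin d → Fin d}
    (hr : ∀ a, IsFreePoint σ a → r a ∈ R) {c : ℕ}
    (hc : ∀ φ ∈ M, {a | ¬ (IsFreePoint σ a ∧ dist (φ a) (g a • φ (r a)) ≤ κ / 2)}.ncard ≤ c) :
    refinedOrd (powerCoverOn 𝒰 M) ≤
      ((R.card / m * k + R.card % m * 𝒲.ncard + c * (𝒰.ncard + 1) : ℕ) : EReal) := by
  classical
  set q := R.card / m
  set l := R.card % m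
  set N := q * k + l * 𝒲.ncard + c * (𝒰.ncard + 1)
  have e : (Fin q × Fin m) ⊕ Fin l ≃ R := by
    refine Fintype.equivOfCardEq ?_
    simp only [Fintype.card_sum, Fintype.card_prod, Fintype.card_fin, Fintype.card_coe]
    exact Nat.div_add_mod' _ _
  have hev : ∀ a, Continuous fun φ : M => φ.1 a := fun a =>
    (continuous_apply a).comp continuous_subtype_val
  let t : Fin d → M → ℝ := fun a φ =>
    if IsFreePoint σ a then dist (φ.1 a) (g a • φ.1 (r a)) / κ else 1
  have ht : ∀ a, Continuous (t a) := by
    intro a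
    by_cases ha : IsFreePoint σ a
    · simp only [t, ha, if_true]
      exact ((hev a).dist ((hev (r a)).const_smul (g a))).div_const κ
    · simp only [t, ha, if_false]
      exact continuous_const
  let ev : Fin q → M → Fin m → X := fun j φ i => φ.1 (e (Sum.inl (j, i)))
  have hevc : ∀ j, Continuous (ev j) := fun j => continuous_pi fun i => hev _
  let f : Fin q ⊕ Fin l ⊕ Fin d → M → ℕ := Sum.elim (fun _ _ => k) <| Sum.elim
    (fun _ _ => 𝒲.ncard) fun a φ => if t a φ ≤ 1 / 2 then 0 else 𝒰.ncard + 1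
  let 𝒱 : Fin q ⊕ Fin l ⊕ Fin d → Set (Set M) :=
    Sum.elim (fun j => (fun V => ev j ⁻¹' V) '' powerCover 𝒲 m) <|
    Sum.elim (fun j => (fun V => (fun φ : M => φ.1 (e (Sum.inr j))) ⁻¹' V) '' 𝒲) fun a =>
      insert {φ | t a φ < 1} ((fun V => (fun φ : M => φ.1 a) ⁻¹' V) '' 𝒰)
  have hcol : ∀ i, HasColouring (𝒱 i) (N + 1) (f i) := by
    rintro (j | j | a)
    · exact (hasColouring_of_refinedOrd_le hk (N + 1)).preimage (hevc j)
    · exact (hasColouring_of_refinedOrd_le (refinedOrd_le_ncard h𝒲) (N + 1)).preimage (hev _)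
    · exact ((hasColouring_of_refinedOrd_le (refinedOrd_le_ncard h𝒰) (N + 1)).preimage
        (hev a)).localize (ht a)
  refine ((HasColouring.join hcol).of_refines ?_).refinedOrd_le fun φ => ?_
  · rintro _ ⟨V, hV, rfl⟩
    -- every representative is the coordinate of a block or of the remainder
    have hrep : ∀ b ∈ R, ∃ W ∈ 𝒲, ∀ φ : M, φ ∈ ⋂ i, V i → φ.1 b ∈ W := by
      intro b hb
      obtain ⟨p, hp⟩ := e.surjective ⟨b, hb⟩
      rcases p with ⟨j, i⟩ | j
      · obtain ⟨_, ⟨W, hW, rfl⟩, hVW⟩ := hV (Sum.inl j) trivial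
        refine ⟨W i, hW i trivial, fun φ hφ => ?_⟩
        have h1 : φ ∈ V (Sum.inl j) := Set.mem_iInter.1 hφ _
        rw [← hVW] at h1
        have h2 : φ.1 (e (Sum.inl (j, i))) ∈ W i := h1 i trivial
        rwa [hp] at h2
      · obtain ⟨W, hW, hVW⟩ := hV (Sum.inr (Sum.inl j)) trivial
        refine ⟨W, hW, fun φ hφ => ?_⟩
        have h1 : φ ∈ V (Sum.inr (Sum.inl j)) := Set.mem_iInter.1 hφ _
        rw [← hVW] at h1
        have h2 : φ.1 (e (Sum.inr j)) ∈ W := h1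
        rwa [hp] at h2
    have hcoord : ∀ a, ∃ U ∈ 𝒰, ∀ φ : M, φ ∈ ⋂ i, V i → φ.1 a ∈ U := by
      intro a
      rcases hV (Sum.inr (Sum.inr a)) trivial with hVa | ⟨U, hU, hVU⟩
      · have hlt : ∀ φ : M, φ ∈ ⋂ i, V i → t a φ < 1 := by
          intro φ hφ
          have h1 : φ ∈ V (Sum.inr (Sum.inr a)) := Set.mem_iInter.1 hφ _
          rwa [hVa] at h1
        by_cases ha : IsFreePoint σ a
        · obtain ⟨W, hW, hφW⟩ := hrep (r a) (hr a ha)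
          obtain ⟨U, hU, hWU⟩ := hfine W hW (g a)
          refine ⟨U, hU, fun φ hφ => hWU _ (hφW φ hφ) _ ?_⟩
          have h1 := hlt φ hφ
          simp only [t, ha, if_true] at h1
          rwa [div_lt_one hκ] at h1
        · -- here `t a = 1`, so that the intersection is empty
          have hempty : ∀ φ : M, φ ∉ ⋂ i, V i := by
            intro φ hφ
            have h1 := hlt φ hφ
            simp only [t, ha, if_false] at h1
            exact lt_irrefl _ h1
          obtain ⟨U, hU, -⟩ : Classical.arbitrary X ∈ ⋃₀ 𝒰 := h𝒰.sUnion_eq ▸ Set.mem_univ _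
          exact ⟨U, hU, fun φ hφ => (hempty φ hφ).elim⟩
      · refine ⟨U, hU, fun φ hφ => ?_⟩
        have h1 : φ ∈ V (Sum.inr (Sum.inr a)) := Set.mem_iInter.1 hφ _
        rw [← hVU] at h1
        exact h1
    choose U hU hφU using hcoord
    exact ⟨_, ⟨U, hU, rfl⟩, fun φ hφ a => hφU a φ hφ⟩
  · simp only [Fintype.sum_sum_type, f, Sum.elim_inl, Sum.elim_inr, Finset.sum_const,
      Finset.card_univ, Fintype.card_fin, smul_eq_mul, Finset.sum_ite, mul_zero, zero_add]
    rw [← add_assoc]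
    refine Nat.add_le_add_left (Nat.mul_le_mul_right _ (le_trans ?_ (hc φ.1 φ.2))) _
    rw [← Set.ncard_coe_finset]
    refine Set.ncard_le_ncard fun a ha hcon => ?_
    refine (Finset.mem_filter.1 (Finset.mem_coe.1 ha)).2 ?_
    simp only [t, hcon.1, if_true]
    rw [div_le_iff₀ hκ]
    linarith [hcon.2]

/-- For approximately equivariant maps with a small tolerance, all but a proportion `2η` of the
points are free and have an almost equivariant value. -/
lemma exists_delta_eventually_card_far_le [Fintype G] (S : SoficApproximation G) {κ η : ℝ}
    (hκ : 0 < κ) (hη : 0 < η) : ∃ δ : ℝ, 0 < δ ∧ ∀ᶠ i in atTop,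
      ∀ (g : Fin (S.d i) → G) (r : Fin (S.d i) → Fin (S.d i)),
      (∀ a, IsFreePoint (S.σ i) a → S.σ i (g a) (r a) = a) →
      ∀ φ ∈ approxEquivariantMaps X Finset.univ δ (S.σ i),
        {a | ¬ (IsFreePoint (S.σ i) a ∧ dist (φ a) (g a • φ (r a)) ≤ κ / 2)}.ncard
          ≤ ⌊2 * η * S.d i⌋₊ := by
  classical
  have hG : (0 : ℝ) < Fintype.card G := by exact_mod_cast Fintype.card_pos
  have hpos : 0 < η * (κ / 2) ^ 2 / Fintype.card G := by positivity
  -- Chebyshev's inequality gives at most `|G| d δ² / (κ/2)² = η d` exceptions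
  refine ⟨Real.sqrt (η * (κ / 2) ^ 2 / Fintype.card G), Real.sqrt_pos.2 hpos, ?_⟩
  filter_upwards [eventually_card_not_isFreePoint_le S hη] with i hi g r hr φ hφ
  refine Nat.le_floor ?_
  have h1 := card_far_mul_sq_le hφ (Real.sqrt_nonneg _) hr (half_pos hκ).le
  rw [Real.sq_sqrt hpos.le] at h1
  have h2 : ((Finset.univ.filter fun a => IsFreePoint (S.σ i) a ∧
      κ / 2 < dist (φ a) (g a • φ (r a))).card : ℝ) ≤ η * S.d i := by
    refine le_of_mul_le_mul_right (h1.trans (le_of_eq ?_)) (by positivity : (0 : ℝ) < (κ / 2) ^ 2)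
    field_simp
  have h3 : {a | ¬ (IsFreePoint (S.σ i) a ∧ dist (φ a) (g a • φ (r a)) ≤ κ / 2)}.ncard ≤
      (Finset.univ.filter fun a => ¬ IsFreePoint (S.σ i) a).card +
      (Finset.univ.filter fun a => IsFreePoint (S.σ i) a ∧
        κ / 2 < dist (φ a) (g a • φ (r a))).card := by
    refine le_trans ?_ (Finset.card_union_le _ _)
    rw [← Set.ncard_coe_finset]
    refine Set.ncard_le_ncard fun a ha => ?_
    rw [Set.mem_ofPred_eq] at ha
    simp only [Finset.coe_union, Finset.coe_filter, Finset.mem_univ, true_and, Set.mem_union,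
      Set.mem_ofPred_eq]
    by_cases hfree : IsFreePoint (S.σ i) a
    · exact Or.inr ⟨hfree, not_le.1 fun h => ha ⟨hfree, h⟩⟩
    · exact Or.inl hfree
  have h4 := (Nat.cast_le (α := ℝ)).2 h3
  push_cast at h4
  linarith

lemma soficOrd_le_of_eventually_le {S : SoficApproximation G} {𝒰 : Set (Set X)} {F : Finset G}
    {δ : ℝ} {c : EReal} (h : ∀ᶠ i in atTop,
      refinedOrd (powerCoverOn 𝒰 (approxEquivariantMaps X F δ (S.σ i))) /
        ((S.d i : ℕ) : EReal) ≤ c) :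
    soficOrd S 𝒰 F δ ≤ c := by
  unfold soficOrd
  split_ifs
  · exact bot_le
  · exact limsup_le_of_le (by isBoundedDefault) h

lemma soficMeanDim_eq_bot_of_isEmpty [IsEmpty X] (S : SoficApproximation G) :
    soficMeanDim S X = ⊥ := by
  refine eq_bot_iff.2 (iSup₂_le fun 𝒰 _ => ?_)
  refine iInf₂_le_of_le {1} (Finset.singleton_nonempty 1) (iInf₂_le_of_le 1 one_pos ?_)
  unfold soficOrd
  rw [if_pos]
  exact Eventually.of_forall fun i =>
    Set.eq_empty_of_forall_notMem fun φ _ => isEmptyElim (φ ⟨0, S.d_pos i⟩)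

/-- The inequality for a fixed block length `m`. With tolerance `η` the main estimate bounds
`𝒟(𝒰^d|_Map) / d` by `k / (|G| m)`, where `k = 𝒟(𝒲^m) ≤ dim X^m`, plus an error consisting of
`m |𝒲| / d` for the incomplete block and `2η (|𝒰| + 1)` for the exceptional points. -/
lemma soficMeanDim_le_coveringDim_pow_div [Finite G] [CompactSpace X] [ContinuousConstSMul G X]
    (S : SoficApproximation G) {m : ℕ} (hm : 0 < m) :
    soficMeanDim S X ≤
      (1 / ((Nat.card G : ℕ) : EReal)) * (coveringDim (Fin m → X) / ((m : ℕ) : EReal)) := by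
  have := Fintype.ofFinite G
  rcases isEmpty_or_nonempty X with hX | hX
  · rw [soficMeanDim_eq_bot_of_isEmpty]
    exact bot_le
  refine iSup₂_le fun 𝒰 h𝒰 => ?_
  obtain ⟨𝒲, κ, h𝒲, hκ, hfine⟩ := exists_fine_cover (G := G) h𝒰
  obtain ⟨k, hk⟩ := exists_refinedOrd_eq_natCast (h𝒲.powerCover m)
  have hG : (0 : ℝ) < Nat.card G := by exact_mod_cast Nat.card_pos
  have hm' : (0 : ℝ) < m := by exact_mod_cast hm
  have hmain : ∀ z : ℝ, ((1 / (Nat.card G : ℝ) * (k / m) : ℝ) : EReal) < z →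
      (⨅ (F : Finset G) (_ : F.Nonempty) (δ : ℝ) (_ : 0 < δ), soficOrd S 𝒰 F δ) ≤ (z : EReal) := by
    intro z hz
    have hz' := EReal.coe_lt_coe_iff.1 hz
    set ε := z - 1 / (Nat.card G : ℝ) * (k / m) with hε
    have hε0 : 0 < ε := sub_pos.2 hz'
    have hu : (0 : ℝ) < 𝒰.ncard + 1 := by positivity
    obtain ⟨δ, hδ, hev⟩ := exists_delta_eventually_card_far_le (X := X) S hκ
      (η := ε / (4 * (𝒰.ncard + 1))) (by positivity)
    refine iInf₂_le_of_le Finset.univ Finset.univ_nonempty (iInf₂_le_of_le δ hδ ?_)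
    refine soficOrd_le_of_eventually_le ?_
    have hlarge := ((tendsto_natCast_atTop_atTop (R := ℝ)).comp S.tendsto_d).eventually_ge_atTop
      (2 * (m * 𝒲.ncard) / ε)
    filter_upwards [hev, hlarge] with i hi hdi
    have hd : (0 : ℝ) < S.d i := by exact_mod_cast S.d_pos i
    obtain ⟨R, g, r, hR, hgr⟩ := exists_orbit_representatives (S.σ i)
    have hbound := refinedOrd_powerCoverOn_le h𝒰 h𝒲 hκ hfine hk.le (fun a ha => (hgr a ha).1)
      (hi g r fun a ha => (hgr a ha).2)
    refine (EReal.div_le_div_right_of_nonneg (by positivity) hbound).trans ?_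
    rw [← EReal.coe_natCast, ← EReal.coe_natCast, ← EReal.coe_div, EReal.coe_le_coe_iff,
      div_le_iff₀ hd]
    push_cast
    have hq : (((R.card / m : ℕ) : ℝ)) * k ≤ 1 / (Nat.card G : ℝ) * (k / m) * S.d i := by
      have h1 : (Nat.card G : ℝ) * R.card ≤ S.d i := by
        rw [Nat.card_eq_fintype_card]; exact_mod_cast hR
      have h2 : ((R.card / m : ℕ) : ℝ) * m ≤ R.card := by
        exact_mod_cast Nat.div_mul_le_self R.card m
      have h3 : ((R.card / m : ℕ) : ℝ) ≤ S.d i / (Nat.card G * m) := by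
        rw [le_div_iff₀ (by positivity)]
        nlinarith
      calc ((R.card / m : ℕ) : ℝ) * k ≤ S.d i / (Nat.card G * m) * k :=
            mul_le_mul_of_nonneg_right h3 (Nat.cast_nonneg k)
        _ = 1 / (Nat.card G : ℝ) * (k / m) * S.d i := by field_simp
    have hl : ((R.card % m : ℕ) : ℝ) * 𝒲.ncard ≤ ε / 2 * S.d i := by
      have h1 : ((R.card % m : ℕ) : ℝ) ≤ m := by exact_mod_cast (Nat.mod_lt _ hm).le
      have h2 : 2 * (m * 𝒲.ncard : ℝ) ≤ S.d i * ε := (div_le_iff₀ hε0).1 hdi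
      have h3 := mul_le_mul_of_nonneg_right h1 (Nat.cast_nonneg (α := ℝ) 𝒲.ncard)
      linarith
    have hc : (⌊2 * (ε / (4 * (𝒰.ncard + 1))) * S.d i⌋₊ : ℝ) * (𝒰.ncard + 1) ≤ ε / 2 * S.d i := by
      have h1 := Nat.floor_le (a := 2 * (ε / (4 * (𝒰.ncard + 1))) * S.d i) (by positivity)
      refine (mul_le_mul_of_nonneg_right h1 hu.le).trans (le_of_eq ?_)
      field_simp
      norm_num
    have hz2 : z = 1 / (Nat.card G : ℝ) * (k / m) + ε := by rw [hε]; ring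
    rw [hz2]
    linarith
  refine (EReal.le_of_forall_lt_iff_le.1 hmain).trans ?_
  have hk' : (k : EReal) ≤ coveringDim (Fin m → X) :=
    hk ▸ refinedOrd_le_coveringDim (h𝒲.powerCover m)
  rw [EReal.coe_mul, EReal.coe_div, EReal.coe_div, EReal.coe_natCast, EReal.coe_natCast,
    EReal.coe_natCast, EReal.coe_one]
  exact mul_le_mul_of_nonneg_left (EReal.div_le_div_right_of_nonneg (by positivity) hk')
    (EReal.div_nonneg zero_le_one (by positivity))

end UpperBound

/-! ### The mean dimension of an action of a finite group -/

section MeanDim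

variable {G X : Type*} [Group G] [MulAction G X]

lemma refines_coverJoin {𝒰 : Set (Set X)} {F : Finset G} (h : (1 : G) ∈ F) :
    Refines (coverJoin 𝒰 F) 𝒰 := by
  rintro _ ⟨U, hU, rfl⟩
  exact ⟨U 1, hU 1 h, fun x hx => by simpa using hx 1 h⟩

variable [TopologicalSpace X]

lemma IsFiniteOpenCover.coverJoin [ContinuousConstSMul G X] {𝒰 : Set (Set X)}
    (h : IsFiniteOpenCover 𝒰) [Finite G] (F : Finset G) : IsFiniteOpenCover (coverJoin 𝒰 F) := by
  classical
  refine ⟨?_, ?_, Set.eq_univ_of_forall fun x => ?_⟩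
  · -- only the values of the choice function on `F` matter, the others can be taken to be `univ`
    refine ((Set.Finite.pi fun _ : G => h.finite.insert Set.univ).image
      fun U => {x | ∀ s ∈ F, s • x ∈ U s}).subset ?_
    rintro _ ⟨U, hU, rfl⟩
    refine ⟨fun s => if s ∈ F then U s else Set.univ, fun s _ => ?_, ?_⟩
    · by_cases hs : s ∈ F
      · simpa [hs] using Or.inr (hU s hs)
      · simp [hs]
    · ext x
      exact forall₂_congr fun s hs => by simp [hs]
  · rintro _ ⟨U, hU, rfl⟩
    have : {x | ∀ s ∈ F, s • x ∈ U s} = ⋂ s ∈ F, (fun x => s • x) ⁻¹' U s := by ext; simp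
    rw [this]
    exact isOpen_biInter_finset fun s hs =>
      (h.isOpen _ (hU s hs)).preimage (continuous_const_smul s)
  · have hx : ∀ s : G, ∃ U ∈ 𝒰, s • x ∈ U := fun s =>
      Set.mem_sUnion.1 (h.sUnion_eq ▸ Set.mem_univ (s • x))
    choose U hU hxU using hx
    exact ⟨_, ⟨U, fun s _ => hU s, rfl⟩, fun s _ => hxU s⟩

/-- In a finite group the only sufficiently left invariant finite set is the whole group. -/
lemma meanDimCover_eq [Fintype G] (𝒰 : Set (Set X)) :
    meanDimCover G 𝒰 =
      refinedOrd (coverJoin 𝒰 (Finset.univ : Finset G)) / ((Nat.card G : ℕ) : EReal) := by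
  classical
  have hG : (0 : ℝ) < Fintype.card G := by exact_mod_cast Fintype.card_pos
  have hcard : ((Finset.univ : Finset G).card : EReal) = ((Nat.card G : ℕ) : EReal) := by
    rw [Finset.card_univ, Nat.card_eq_fintype_card]
  refine le_antisymm ?_ ?_
  · refine iInf₂_le_of_le Finset.univ Finset.univ_nonempty
      (iInf₂_le_of_le (1 / Fintype.card G) (by positivity) ?_)
    refine iSup₂_le fun F hF => iSup_le fun hlt => ?_
    have hFu : F = Finset.univ := by
      have h1 : (F.card : ℝ) ≤ Fintype.card G := by exact_mod_cast Finset.card_le_univ F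
      have h2 : 1 / (Fintype.card G : ℝ) * F.card ≤ 1 := by
        rw [one_div, inv_mul_le_iff₀ hG]; simpa using h1
      have h3 := hlt.trans_le h2
      rw [Nat.cast_lt_one, Finset.card_eq_zero, Finset.sdiff_eq_empty_iff_subset] at h3
      obtain ⟨f, hf⟩ := hF
      refine Finset.eq_univ_of_forall fun s => h3 ?_
      exact Finset.mem_mul.2 ⟨s * f⁻¹, Finset.mem_univ _, f, hf, by simp⟩
    rw [hFu, hcard]
  · refine le_iInf₂ fun K _ => le_iInf₂ fun δ hδ => ?_
    refine le_iSup₂_of_le Finset.univ Finset.univ_nonempty (le_iSup_of_le ?_ ?_)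
    · rw [Finset.sdiff_eq_empty_iff_subset.2 (Finset.subset_univ _)]
      simpa using mul_pos hδ hG
    · rw [hcard]

lemma meanDim_eq [Finite G] [ContinuousConstSMul G X] :
    meanDim G X = (1 / ((Nat.card G : ℕ) : EReal)) * coveringDim X := by
  have := Fintype.ofFinite G
  have hG : (0 : EReal) < ((Nat.card G : ℕ) : EReal) := by exact_mod_cast Nat.card_pos (α := G)
  have hG' : ((Nat.card G : ℕ) : EReal) ≠ ⊤ := EReal.natCast_ne_top _
  rw [one_div, ← EReal.div_eq_inv_mul]
  refine le_antisymm (iSup₂_le fun 𝒰 h𝒰 => ?_) ?_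
  · rw [meanDimCover_eq]
    exact EReal.div_le_div_right_of_nonneg hG.le
      (refinedOrd_le_coveringDim (h𝒰.coverJoin Finset.univ))
  · rw [EReal.div_le_iff_le_mul hG hG']
    refine iSup₂_le fun 𝒰 h𝒰 => ?_
    rw [← EReal.div_le_iff_le_mul hG hG']
    refine (EReal.div_le_div_right_of_nonneg hG.le
      (refinedOrd_le_of_refines (refines_coverJoin (Finset.mem_univ (1 : G))))).trans ?_
    rw [← meanDimCover_eq]
    exact le_iSup₂_of_le 𝒰 h𝒰 le_rfl

end MeanDim

end SoficMeanDim

theorem mainTheorem12 {G : Type*} [Group G] [Finite G] (S : SoficMeanDim.SoficApproximation G)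
    {X : Type*} [MetricSpace X] [CompactSpace X] [MulAction G X] [ContinuousConstSMul G X]
    (hdim : SoficMeanDim.coveringDim X < ⊤) :
    SoficMeanDim.soficMeanDim S X ≤
        (1 / ((Nat.card G : ℕ) : EReal)) *
          ⨅ m : ℕ+, SoficMeanDim.coveringDim (Fin (m : ℕ) → X) / (((m : ℕ) : ℕ) : EReal) ∧
      SoficMeanDim.meanDim G X = (1 / ((Nat.card G : ℕ) : EReal)) * SoficMeanDim.coveringDim X ∧
      (SoficMeanDim.coveringDim (Fin 2 → X) < 2 * SoficMeanDim.coveringDim X →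
        SoficMeanDim.soficMeanDim S X < SoficMeanDim.meanDim G X) := by
  have hG : (0 : EReal) < ((Nat.card G : ℕ) : EReal) := by exact_mod_cast Nat.card_pos (α := G)
  have hG' : ((Nat.card G : ℕ) : EReal) ≠ ⊤ := EReal.natCast_ne_top _
  refine ⟨?_, SoficMeanDim.meanDim_eq, fun h2 => ?_⟩
  · rw [one_div, ← EReal.div_eq_inv_mul, EReal.le_div_iff_mul_le hG hG']
    refine le_iInf fun m => ?_
    rw [← EReal.le_div_iff_mul_le hG hG', EReal.div_eq_inv_mul, ← one_div]
    exact SoficMeanDim.soficMeanDim_le_coveringDim_pow_div S m.pos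
  · refine (SoficMeanDim.soficMeanDim_le_coveringDim_pow_div S two_pos).trans_lt ?_
    rw [SoficMeanDim.meanDim_eq, one_div, ← EReal.div_eq_inv_mul, ← EReal.div_eq_inv_mul]
    refine EReal.div_lt_div_right_of_pos hG hG' ?_
    rw [EReal.div_lt_iff (by norm_num) (EReal.natCast_ne_top 2), mul_comm]
    exact_mod_cast h2
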